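/- Let $n$ be a positive integer and $1<p<n$. Let $L_0^{1,p}(\mathbb R^n)$ be the homogeneous Sobolev space of all $u\in W^{1,p}_{\rm loc}(\mathbb R^n)$ with $u\in L^{np/(n-p)}(\mathbb R^n)$ and $|\nabla u|\in L^p(\mathbb R^n)$, normed by $\|u\|_{1,p}=\big(\int_{\mathbb R^n}|\nabla u|^p\,dx\big)^{1/p}$ (in which $C_0^\infty(\mathbb R^n)$ is dense), and let $L^{-1,p'}(\mathbb R^n)$ be its dual: a nonnegative Borel measure $\mu$ on $\mathbb R^n$, finite on compact sets, belongs to $L^{-1,p'}(\mathbb R^n)$ if there is a constant $C$ with $\big|\int\varphi\,d\mu\big|\le C\|\varphi\|_{1,p}$ for all $\varphi\in C_0^\infty(\mathbb R^n)$. For compact $K\subset\mathbb R^n$ put $$\mathrm{cap}_p(K)=\inf\Big\{\int_{\mathbb R^n}|\nabla\varphi|^p\,dx:\ \varphi\in C_0^\infty(\mathbb R^n),\ \varphi\ge 1\text{ on }K\Big\};$$ for open $U$ let $\mathrm{cap}_p(U)$ be the supremum of $\mathrm{cap}_p(K)$ over compact $K\subset U$, and for arbitrary $A$ let $\mathrm{cap}_p(A)$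 be the infimum of $\mathrm{cap}_p(U)$ over open $U\supset A$. A property holds quasi-everywhere (q.e.) if it holds outside a set of $p$-capacity zero. A function $f:\mathbb R^n\to[-\infty,\infty]$ is quasicontinuous if for every $\varepsilon>0$ there is an open set $O$ with $\mathrm{cap}_p(O)<\varepsilon$ such that the restriction of $f$ to $\mathbb R^n\setminus O$ is continuous. **Lemma 3.7 (weak comparison principle).** Let $\mu,\omega$ be nonnegative Borel measures on $\mathbb R^n$, finite on compact sets, which belong to $L^{-1,p'}(\mathbb R^n)$. Let $u,v\in L_0^{1,p}(\mathbb R^n)$ be solutions of $-\Delta_p u=\mu$ and $-\Delta_p v=\omega$ in the sense of distributions, that is, $$\int_{\mathbb R^n}|\nabla u|^{p-2}\nabla u\cdot\nabla\varphi\,dx=\int_{\mathbb R^n}\varphi\,d\mu,\qquad \int_{\mathbb R^n}|\nabla v|^{p-2}\nabla v\cdot\nabla\varphi\,dx=\int_{\mathbb R^n}\varphi\,d\omega$$ for all $\varphi\in C_0^\infty(\mathbb R^n)$. If $\mu\le\omega$, then $u\le v$ quasi-everywhere, where $u$ and $v$ denote any quasicontinuous representatives (functions that agree with $u$, respectively $v$,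 almost everywhere). -/

import Mathlib

noncomputable section

namespace PLap

open MeasureTheory
open scoped ENNReal ContDiff

/-- Euclidean space `ℝⁿ` (with the Euclidean norm). -/
abbrev E (n : ℕ) : Type := EuclideanSpace ℝ (Fin n)

/-- Test functions: the class `C₀^∞(ℝⁿ)`. -/
def IsTest {n : ℕ} (φ : E n → ℝ) : Prop :=
  ContDiff ℝ ∞ φ ∧ HasCompactSupport φ

/-- `G` is the weak (distributional) gradient of `u`. -/
structure HasWeakGradient {n : ℕ} (u : E n → ℝ) (G : E n → E n) : Prop where
  locallyIntegrable : LocallyIntegrable u volume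
  locallyIntegrable_grad : LocallyIntegrable G volume
  integral_eq : ∀ φ : E n → ℝ, IsTest φ →
    ∫ x, u x • gradient φ x = - ∫ x, φ x • G x

/-- `f ∈ L^p_loc(ℝⁿ)`. -/
def MemLpLoc {n : ℕ} {F : Type*} [NormedAddCommGroup F] (p : ℝ) (f : E n → F) : Prop :=
  ∀ K : Set (E n), IsCompact K → MemLp f (ENNReal.ofReal p) (volume.restrict K)

/-- The homogeneous Sobolev (Dirichlet) space `L₀^{1,p}(ℝⁿ)`, `1 < p < n`: functions
`u ∈ W^{1,p}_loc(ℝⁿ)` with `u ∈ L^{np/(n-p)}(ℝⁿ)` and `|∇u| ∈ L^p(ℝⁿ)`. -/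
def MemL01p {n : ℕ} (p : ℝ) (u : E n → ℝ) : Prop :=
  MemLpLoc p u ∧
  MemLp u (ENNReal.ofReal (n * p / (n - p))) volume ∧
  ∃ G : E n → E n, HasWeakGradient u G ∧ MemLp G (ENNReal.ofReal p) volume

/-- The Radon measure `μ`, seen as the distribution `φ ↦ ∫ φ dμ`, belongs to the dual Sobolev space
`L^{-1,p'}(ℝⁿ) = L₀^{1,p}(ℝⁿ)^*`. As `C₀^∞(ℝⁿ)` is dense in `L₀^{1,p}(ℝⁿ)`, this means that it is
bounded on test functions with respect to the norm `‖φ‖_{1,p} = (∫ |∇φ|^p dx)^{1/p}`. -/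
def MemDual {n : ℕ} (p : ℝ) (μ : Measure (E n)) : Prop :=
  ∃ C : ℝ, ∀ φ : E n → ℝ, IsTest φ →
    |∫ x, φ x ∂μ| ≤ C * (∫ x, ‖gradient φ x‖ ^ p) ^ (1 / p)

/-- `-Δ_p u = μ` in the sense of distributions:
`∫ |∇u|^{p-2} ∇u · ∇φ dx = ∫ φ dμ` for all test functions `φ`, where `∇u` is the weak gradient
(unique up to a null set). -/
def SolvesPLaplace {n : ℕ} (p : ℝ) (u : E n → ℝ) (μ : Measure (E n)) : Prop :=
  ∃ G : E n → E n, HasWeakGradient u G ∧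
    ∀ φ : E n → ℝ, IsTest φ →
      ∫ x, ‖G x‖ ^ (p - 2) * inner ℝ (G x) (gradient φ x) = ∫ x, φ x ∂μ

/-- The `p`-capacity of a compact set:
`cap_p(K) = inf { ∫ |∇φ|^p dx : φ ∈ C₀^∞(ℝⁿ), φ ≥ 1 on K }`. -/
def capCompact {n : ℕ} (p : ℝ) (K : Set (E n)) : ℝ≥0∞ :=
  ⨅ (φ : E n → ℝ) (_ : IsTest φ) (_ : ∀ x ∈ K, 1 ≤ φ x), ∫⁻ x, ‖gradient φ x‖ₑ ^ p

/-- The `p`-capacity of an open set: the supremum over its compact subsets. -/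
def capOpen {n : ℕ} (p : ℝ) (U : Set (E n)) : ℝ≥0∞ :=
  ⨆ (K : Set (E n)) (_ : IsCompact K) (_ : K ⊆ U), capCompact p K

/-- The `p`-capacity of an arbitrary set: the infimum over the open sets that contain it. -/
def cap {n : ℕ} (p : ℝ) (A : Set (E n)) : ℝ≥0∞ :=
  ⨅ (U : Set (E n)) (_ : IsOpen U) (_ : A ⊆ U), capOpen p U

/-- `f` is (`p`-)quasicontinuous: it is continuous off open sets of arbitrarily small capacity.
Infinite values are allowed, as for superharmonic functions. -/
def Quasicontinuous {n : ℕ} (p : ℝ) (f : E n → EReal) : Prop :=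
  ∀ ε : ℝ≥0∞, 0 < ε → ∃ O : Set (E n), IsOpen O ∧ cap p O < ε ∧ ContinuousOn f Oᶜ

/-- `f` is a quasicontinuous representative of the (almost everywhere defined) function `u`. -/
def IsQuasicontinuousRep {n : ℕ} (p : ℝ) (f : E n → EReal) (u : E n → ℝ) : Prop :=
  Quasicontinuous p f ∧ ∀ᵐ x ∂(volume : Measure (E n)), f x = (u x : EReal)

/-- `P` holds quasi-everywhere, that is, off a set of `p`-capacity zero. -/
def QuasiEverywhere {n : ℕ} (p : ℝ) (P : E n → Prop) : Prop :=
  cap p {x | ¬ P x} = 0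

end PLap

end

/-!
The proof has two independent halves.

*Comparison almost everywhere* (`ae_le_of_solvesPLaplace`). Put `w = u - v` and let `H` be its weak
gradient. The classical argument tests the difference of the two equations with the positive part
of `w`. Here the positive part is replaced by `ψ(w)`, where `ψ = expNegInvGlue` is smooth, bounded
with bounded derivative, zero on `(-∞, 0]` and positive with positive derivative on `(0, ∞)`.
Test functions are dense in the homogeneous Sobolev space (`exists_isTest_approx`: cut off, then
mollify), so composing with `ψ` yields nonnegative test functions `φ_k → ψ(w)` with
`∇φ_k → ψ'(w) H` in `L^p` (`exists_nonneg_isTest_approx`). As `μ ≤ ω`, testing with `φ_k` and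
passing to the limit gives `∫ ψ'(w) (|∇u|^{p-2}∇u - |∇v|^{p-2}∇v) · (∇u - ∇v) ≤ 0`. The integrand
is nonnegative, so strict monotonicity of `a ↦ |a|^{p-2}a` forces `ψ'(w) H = 0`; hence `∇φ_k → 0`
in `L^p`, and by the Sobolev inequality and Fatou's lemma `ψ(w) = 0`, that is, `u ≤ v`.

*From almost everywhere to quasi-everywhere* (`quasiEverywhere_le_of_ae_le`). Let `f ≤ g` almost
everywhere, with `f` and `g` continuous off open sets `O₁` and `O₂` of small capacity. Then
`W = {f > g} ∪ O₁ ∪ O₂` is open and differs from `O₁ ∪ O₂` by a Lebesgue null set. Such a `W` has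
small capacity too (`capOpen_le_of_volume_diff_eq_zero`): given a compact `K ⊆ W`, take test
functions of small energy for a compact set `L ⊆ O₁ ∪ O₂` that fills a neighbourhood of `K` up to
small measure, make them nonnegative, add them and mollify. The mollified function is bounded below
on `K`, because convolution does not see the small set missed by `L`, and mollification does not
increase the energy. Only the smallness of the capacity matters, so the constants lost on the way
are harmless.
-/

noncomputable section

namespace PLap

open MeasureTheory Filter Topology ContinuousLinearMap
open scoped ENNReal ContDiff Convolution NNReal

variable {n : ℕ} {F : Type*} [NormedAddCommGroup F] [NormedSpace ℝ F]

/-! ### Mollification -/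

/-- The mollification of `f` by the normalised bump function `b`. -/
def mollify (b : ContDiffBump (0 : E n)) (f : E n → F) : E n → F :=
  b.normed volume ⋆[lsmul ℝ ℝ, volume] f

theorem mollify_apply (b : ContDiffBump (0 : E n)) (f : E n → F) (x : E n) :
    mollify b f x = ∫ t, b.normed volume t • f (x - t) := rfl

theorem mollify_apply' (b : ContDiffBump (0 : E n)) (f : E n → F) (x : E n) :
    mollify b f x = ∫ t, b.normed volume (x - t) • f t := by
  rw [mollify, convolution_eq_swap]; rfl

theorem lintegral_ofReal_normed (b : ContDiffBump (0 : E n)) :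
    ∫⁻ t, ENNReal.ofReal (b.normed volume t) = 1 := by
  rw [← ofReal_integral_eq_lintegral_ofReal b.integrable_normed
    (Eventually.of_forall b.nonneg_normed), b.integral_normed, ENNReal.ofReal_one]

theorem aestronglyMeasurable_sub_left {F : Type*} [NormedAddCommGroup F] {f : E n → F}
    (hf : AEStronglyMeasurable f volume) (x : E n) :
    AEStronglyMeasurable (fun t => f (x - t)) volume :=
  hf.comp_quasiMeasurePreserving (quasiMeasurePreserving_sub_left volume x)

/-- Jensen's inequality for the probability density of a mollifier. -/
theorem enorm_mollify_rpow_le (b : ContDiffBump (0 : E n)) {f : E n → F}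
    (hf : AEStronglyMeasurable f volume) {r : ℝ} (hr : 1 ≤ r) (x : E n) :
    ‖mollify b f x‖ₑ ^ r ≤ ∫⁻ t, ENNReal.ofReal (b.normed volume t) * ‖f (x - t)‖ₑ ^ r := by
  have hr0 : 0 < r := by linarith
  have hm : Measurable fun t => ENNReal.ofReal (b.normed volume t) :=
    ENNReal.measurable_ofReal.comp b.continuous_normed.measurable
  set ν : Measure (E n) := volume.withDensity fun t => ENNReal.ofReal (b.normed volume t) with hν
  have : IsProbabilityMeasure ν := ⟨by
    rw [hν, withDensity_apply _ MeasurableSet.univ, Measure.restrict_univ,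
      lintegral_ofReal_normed]⟩
  have hfx := aestronglyMeasurable_sub_left hf x
  have hfν : AEStronglyMeasurable (fun t => f (x - t)) ν :=
    hfx.mono_ac (withDensity_absolutelyContinuous _ _)
  have key := eLpNorm_le_eLpNorm_of_exponent_le (p := 1) (q := ENNReal.ofReal r)
    (by simpa using ENNReal.ofReal_le_ofReal hr) hfν
  rw [eLpNorm_one_eq_lintegral_enorm, eLpNorm_eq_lintegral_rpow_enorm_toReal (by simpa using hr0)
    ENNReal.ofReal_ne_top, ENNReal.toReal_ofReal hr0.le, one_div,
    ENNReal.le_rpow_inv_iff hr0, hν, lintegral_withDensity_eq_lintegral_mul₀ hm.aemeasurable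
      hfx.enorm, lintegral_withDensity_eq_lintegral_mul₀ hm.aemeasurable
      (hfx.enorm.pow_const _)] at key
  refine le_trans ?_ key
  gcongr
  rw [mollify_apply]
  refine (enorm_integral_le_lintegral_enorm _).trans (le_of_eq ?_)
  refine lintegral_congr fun t => ?_
  simp [enorm_smul, Real.enorm_eq_ofReal (b.nonneg_normed t)]

/-- Young's inequality for mollification: it does not increase the `L^r` norm. -/
theorem lintegral_enorm_mollify_rpow_le (b : ContDiffBump (0 : E n)) {f : E n → F}
    (hf : AEStronglyMeasurable f volume) {r : ℝ} (hr : 1 ≤ r) :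
    ∫⁻ x, ‖mollify b f x‖ₑ ^ r ≤ ∫⁻ x, ‖f x‖ₑ ^ r := by
  have hm : Measurable fun t => ENNReal.ofReal (b.normed volume t) :=
    ENNReal.measurable_ofReal.comp b.continuous_normed.measurable
  calc ∫⁻ x, ‖mollify b f x‖ₑ ^ r
      ≤ ∫⁻ x, ∫⁻ t, ENNReal.ofReal (b.normed volume t) * ‖f (x - t)‖ₑ ^ r :=
        lintegral_mono fun x => enorm_mollify_rpow_le b hf hr x
    _ = ∫⁻ t, ∫⁻ x, ENNReal.ofReal (b.normed volume t) * ‖f (x - t)‖ₑ ^ r := by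
        apply lintegral_lintegral_swap
        refine AEMeasurable.mul (hm.comp measurable_snd).aemeasurable ?_
        exact ((hf.comp_quasiMeasurePreserving
          (quasiMeasurePreserving_sub volume volume)).enorm.pow_const r)
    _ = ∫⁻ t, ENNReal.ofReal (b.normed volume t) * ∫⁻ x, ‖f x‖ₑ ^ r := by
        refine lintegral_congr fun t => ?_
        rw [lintegral_const_mul' _ _ ENNReal.ofReal_ne_top,
          lintegral_sub_right_eq_self (fun x => ‖f x‖ₑ ^ r) t]
    _ = ∫⁻ x, ‖f x‖ₑ ^ r := by
        rw [lintegral_mul_const _ hm, lintegral_ofReal_normed, one_mul]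

theorem eLpNorm_mollify_le (b : ContDiffBump (0 : E n)) {f : E n → F}
    (hf : AEStronglyMeasurable f volume) {r : ℝ} (hr : 1 ≤ r) :
    eLpNorm (mollify b f) (ENNReal.ofReal r) volume ≤ eLpNorm f (ENNReal.ofReal r) volume := by
  have hr0 : 0 < r := by linarith
  rw [eLpNorm_eq_lintegral_rpow_enorm_toReal (by simpa using hr0) ENNReal.ofReal_ne_top,
    eLpNorm_eq_lintegral_rpow_enorm_toReal (by simpa using hr0) ENNReal.ofReal_ne_top,
    ENNReal.toReal_ofReal hr0.le]
  exact ENNReal.rpow_le_rpow (lintegral_enorm_mollify_rpow_le b hf hr) (by positivity)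

theorem contDiff_mollify (b : ContDiffBump (0 : E n)) {f : E n → F}
    (hf : LocallyIntegrable f volume) : ContDiff ℝ ∞ (mollify b f) :=
  b.hasCompactSupport_normed.contDiff_convolution_left (n := ⊤) _ b.contDiff_normed hf

theorem hasCompactSupport_mollify (b : ContDiffBump (0 : E n)) {f : E n → F}
    (hf : HasCompactSupport f) : HasCompactSupport (mollify b f) :=
  b.hasCompactSupport_normed.convolution _ hf

theorem convolutionExists_mollify (b : ContDiffBump (0 : E n)) {f : E n → F}
    (hf : LocallyIntegrable f volume) :
    ConvolutionExists (b.normed volume) f (lsmul ℝ ℝ) volume :=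
  b.hasCompactSupport_normed.convolutionExists_left _ b.continuous_normed hf

theorem mollify_sub (b : ContDiffBump (0 : E n)) {f g : E n → F}
    (hf : LocallyIntegrable f volume) (hg : LocallyIntegrable g volume) :
    mollify b (f - g) = mollify b f - mollify b g := by
  ext x
  have h1 := convolutionExists_mollify b hf x
  have h2 := convolutionExists_mollify b hg x
  simp only [ConvolutionExistsAt, lsmul_apply] at h1 h2
  simp only [mollify_apply, Pi.sub_apply, smul_sub]
  exact integral_sub h1 h2

/-- Mollifying a test function, or more generally a `C¹` function with compact support, mollifies
its derivative. -/
theorem fderiv_mollify (b : ContDiffBump (0 : E n)) {f : E n → F}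
    (hf : ContDiff ℝ 1 f) (hfc : HasCompactSupport f) :
    fderiv ℝ (mollify b f) = mollify b (fderiv ℝ f) := by
  ext1 x
  exact (hfc.hasFDerivAt_convolution_right (lsmul ℝ ℝ)
    b.continuous_normed.locallyIntegrable hf x).fderiv

theorem norm_gradient (f : E n → ℝ) (x : E n) : ‖gradient f x‖ = ‖fderiv ℝ f x‖ := by
  simp [gradient]

theorem enorm_gradient (f : E n → ℝ) (x : E n) : ‖gradient f x‖ₑ = ‖fderiv ℝ f x‖ₑ := by
  rw [← ofReal_norm, ← ofReal_norm, norm_gradient]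

/-- Mollification commutes with the weak gradient. -/
theorem gradient_mollify (b : ContDiffBump (0 : E n)) {w : E n → ℝ} {H : E n → E n}
    (hw : HasWeakGradient w H) : gradient (mollify b w) = mollify b H := by
  ext1 x
  have h1 := b.hasCompactSupport_normed.hasFDerivAt_convolution_left (lsmul ℝ ℝ)
    (b.contDiff_normed (μ := volume) (n := 1)) hw.locallyIntegrable x
  -- test the definition of the weak gradient with the kernel `t ↦ η (x - t)`
  have hφ : IsTest fun t => b.normed volume (x - t) :=
    ⟨b.contDiff_normed.comp (contDiff_const.sub contDiff_id),
      b.hasCompactSupport_normed.comp_homeomorph (Homeomorph.subLeft x)⟩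
  have h2 := hw.integral_eq _ hφ
  have h3 : ∀ t, gradient (fun t => b.normed volume (x - t)) t
      = - gradient (b.normed volume) (x - t) := by
    intro t
    have : HasFDerivAt (b.normed volume) (fderiv ℝ (b.normed volume) (x - t)) (x - t) :=
      ((b.contDiff_normed (μ := volume) (n := 1)).differentiable one_ne_zero _).hasFDerivAt
    have h := this.comp t ((hasFDerivAt_id t).const_sub x)
    have h' : fderiv ℝ (fun t => b.normed volume (x - t)) t
        = - fderiv ℝ (b.normed volume) (x - t) := by
      refine (HasFDerivAt.fderiv h).trans ?_
      ext; simp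
    simp [gradient, h']
  simp only [h3, smul_neg, integral_neg, neg_inj] at h2
  rw [mollify_apply', ← h2]
  have h4 : fderiv ℝ (mollify b w) x = ∫ t, w t • fderiv ℝ (b.normed volume) (x - t) := by
    refine (HasFDerivAt.fderiv h1).trans ?_
    rw [convolution_eq_swap]
    refine integral_congr_ae (Eventually.of_forall fun t => ?_)
    ext v
    simp [mul_comm]
  rw [gradient, h4]
  have h5 := ((InnerProductSpace.toDual ℝ (E n)).symm.toContinuousLinearEquiv :
    (E n →L[ℝ] ℝ) ≃L[ℝ] E n).integral_comp_comm
    (μ := volume) (fun t => w t • fderiv ℝ (b.normed volume) (x - t))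
  simp only [map_smul] at h5
  exact h5.symm

/-- Mollifications converge in `L^r` when the radii of the bump functions tend to zero. -/
theorem tendsto_eLpNorm_mollify_sub [CompleteSpace F] {b : ℕ → ContDiffBump (0 : E n)}
    (hb : Tendsto (fun k => (b k).rOut) atTop (𝓝 0)) {r : ℝ} (hr : 1 ≤ r) {f : E n → F}
    (hf : MemLp f (ENNReal.ofReal r) volume) :
    Tendsto (fun k => eLpNorm (mollify (b k) f - f) (ENNReal.ofReal r) volume) atTop (𝓝 0) := by
  have hr1 : 1 ≤ ENNReal.ofReal r := by simpa using ENNReal.ofReal_le_ofReal hr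
  rw [ENNReal.tendsto_nhds_zero]
  intro ε hε
  obtain ⟨δ, hδ, hδε⟩ : ∃ δ : ℝ≥0∞, 0 < δ ∧ δ + δ + δ ≤ ε := by
    refine ⟨ε / 3, ENNReal.div_pos hε.ne' (by simp), (ENNReal.add_thirds ε).le⟩
  obtain ⟨g, hgc, hfg, hg, hgm⟩ :=
    hf.exists_hasCompactSupport_eLpNorm_sub_le ENNReal.ofReal_ne_top hδ.ne'
  have hfl : LocallyIntegrable f volume := hf.locallyIntegrable hr1
  have hgl : LocallyIntegrable g volume := hg.locallyIntegrable
  -- for the continuous function `g` the convergence is uniform, on a fixed compact set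
  set K := Metric.cthickening 1 (tsupport g) with hK
  have hKc : IsCompact K := hgc.isCompact.cthickening
  have hvol : volume K ^ (ENNReal.ofReal r).toReal⁻¹ ≠ ⊤ :=
    ENNReal.rpow_ne_top_of_nonneg (by positivity) hKc.measure_lt_top.ne
  obtain ⟨c, hc, hcδ⟩ : ∃ c : ℝ, 0 < c ∧
      volume K ^ (ENNReal.ofReal r).toReal⁻¹ * ENNReal.ofReal c ≤ δ := by
    obtain ⟨c, hc, hcδ⟩ := ENNReal.exists_pos_mul_lt hvol hδ.ne'
    have hcm := min_le_left c 1
    refine ⟨(min c 1).toReal, ENNReal.toReal_pos (by simp [hc.ne']) (by simp), ?_⟩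
    rw [ENNReal.ofReal_toReal (by simp), mul_comm]
    exact (mul_le_mul_left hcm _).trans hcδ.le
  obtain ⟨d, hd, hdc⟩ := Metric.uniformContinuous_iff.1
    (hgc.uniformContinuous_of_continuous hg) c hc
  filter_upwards [hb.eventually_lt_const hd, hb.eventually_lt_const one_pos] with k hkd hk1
  have hbound : ∀ x, ‖(mollify (b k) g - g) x‖ ≤ c := by
    intro x
    rw [Pi.sub_apply, ← dist_eq_norm]
    refine (b k).dist_normed_convolution_le hg.aestronglyMeasurable fun y hy => (hdc ?_).le
    exact lt_trans (by simpa using hy) hkd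
  have hsupp : Function.support (mollify (b k) g - g) ⊆ K := by
    intro x hx
    by_contra hxK
    have h0 : ∀ y ∈ Metric.ball x (b k).rOut, g y = 0 := by
      intro y hy
      by_contra hy0
      apply hxK
      refine Metric.mem_cthickening_of_dist_le x y 1 _ (subset_tsupport g hy0) ?_
      rw [dist_comm]; exact (Metric.mem_ball.1 hy).le.trans hk1.le
    have hx0 : g x = 0 := h0 x (Metric.mem_ball_self (b k).rOut_pos)
    have := (b k).normed_convolution_eq_right (μ := volume) (g := g) (x₀ := x)
      (fun y hy => by rw [h0 y hy, hx0])
    apply hx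
    rw [Pi.sub_apply, mollify, this, sub_self]
  have hmid : eLpNorm (mollify (b k) g - g) (ENNReal.ofReal r) volume ≤ δ := by
    rw [← eLpNorm_restrict_eq_of_support_subset hsupp]
    refine (eLpNorm_le_of_ae_bound (C := c) (Eventually.of_forall hbound)).trans ?_
    simpa using hcδ
  have hfga : AEStronglyMeasurable (f - g) volume := hf.1.sub hg.aestronglyMeasurable
  have hma : AEStronglyMeasurable (mollify (b k) (f - g)) volume :=
    (contDiff_mollify (b k) (hfl.sub hgl)).continuous.aestronglyMeasurable
  have hga : AEStronglyMeasurable (mollify (b k) g - g) volume :=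
    ((contDiff_mollify (b k) hgl).continuous.sub hg).aestronglyMeasurable
  have hdec : mollify (b k) f - f = mollify (b k) (f - g) + (mollify (b k) g - g) - (f - g) := by
    rw [mollify_sub (b k) hfl hgl]; abel
  rw [hdec]
  refine (eLpNorm_sub_le (hma.add hga) hfga hr1).trans ?_
  refine (add_le_add_left (eLpNorm_add_le hma hga hr1) _).trans ?_
  refine le_trans ?_ hδε
  gcongr
  exact (eLpNorm_mollify_le (b k) hfga hr).trans hfg

/-! ### Gradients and weak gradients -/

theorem gradient_mul {φ χ : E n → ℝ} {x : E n} (hφ : DifferentiableAt ℝ φ x)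
    (hχ : DifferentiableAt ℝ χ x) :
    gradient (fun y => χ y * φ y) x = χ x • gradient φ x + φ x • gradient χ x := by
  simp only [gradient]
  rw [fderiv_fun_mul hχ hφ, map_add, map_smul, map_smul]

theorem IsTest.differentiable {φ : E n → ℝ} (hφ : IsTest φ) : Differentiable ℝ φ :=
  hφ.1.differentiable (by simp)

theorem IsTest.continuous_gradient {φ : E n → ℝ} (hφ : IsTest φ) : Continuous (gradient φ) :=
  (InnerProductSpace.toDual ℝ (E n)).symm.continuous.comp (hφ.1.continuous_fderiv (by simp))

theorem hasCompactSupport_gradient {φ : E n → ℝ} (hφ : HasCompactSupport φ) :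
    HasCompactSupport (gradient φ) :=
  (hφ.fderiv ℝ).comp_left (g := (InnerProductSpace.toDual ℝ (E n)).symm) (map_zero _)

/-- Weak gradients are determined almost everywhere. -/
theorem HasWeakGradient.ae_eq {u : E n → ℝ} {G G' : E n → E n} (h : HasWeakGradient u G)
    (h' : HasWeakGradient u G') : G =ᵐ[volume] G' := by
  refine ae_eq_of_integral_contDiff_smul_eq h.locallyIntegrable_grad h'.locallyIntegrable_grad
    fun φ hφ hφc => ?_
  have h1 := h.integral_eq φ ⟨hφ, hφc⟩
  have h2 := h'.integral_eq φ ⟨hφ, hφc⟩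
  exact neg_injective (h1.symm.trans h2)

theorem HasWeakGradient.sub {u v : E n → ℝ} {G H : E n → E n} (hu : HasWeakGradient u G)
    (hv : HasWeakGradient v H) : HasWeakGradient (u - v) (G - H) where
  locallyIntegrable := hu.locallyIntegrable.sub hv.locallyIntegrable
  locallyIntegrable_grad := hu.locallyIntegrable_grad.sub hv.locallyIntegrable_grad
  integral_eq φ hφ := by
    have hc := hφ.continuous_gradient
    have hs := hasCompactSupport_gradient hφ.2
    simp only [Pi.sub_apply, sub_smul, smul_sub]
    rw [integral_sub (hu.locallyIntegrable.integrable_smul_right_of_hasCompactSupport hc hs)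
      (hv.locallyIntegrable.integrable_smul_right_of_hasCompactSupport hc hs),
      integral_sub
      (hu.locallyIntegrable_grad.integrable_smul_left_of_hasCompactSupport hφ.1.continuous hφ.2)
      (hv.locallyIntegrable_grad.integrable_smul_left_of_hasCompactSupport hφ.1.continuous hφ.2),
      hu.integral_eq φ hφ, hv.integral_eq φ hφ]
    abel

/-- The product rule for the weak gradient of `χ u`, `χ` a test function. -/
theorem HasWeakGradient.test_mul {w : E n → ℝ} {H : E n → E n} (hw : HasWeakGradient w H)
    {χ : E n → ℝ} (hχ : IsTest χ) :
    HasWeakGradient (fun x => χ x * w x) (fun x => χ x • H x + w x • gradient χ x) where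
  locallyIntegrable :=
    (hw.locallyIntegrable.integrable_smul_left_of_hasCompactSupport hχ.1.continuous
      hχ.2).locallyIntegrable
  locallyIntegrable_grad :=
    ((hw.locallyIntegrable_grad.integrable_smul_left_of_hasCompactSupport hχ.1.continuous
      hχ.2).add (hw.locallyIntegrable.integrable_smul_right_of_hasCompactSupport
        hχ.continuous_gradient (hasCompactSupport_gradient hχ.2))).locallyIntegrable
  integral_eq φ hφ := by
    have hχφ : IsTest fun x => χ x * φ x := ⟨hχ.1.mul hφ.1, hφ.2.mul_left⟩
    have h := hw.integral_eq _ hχφ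
    have hint : ∀ {α β : E n → ℝ}, IsTest α → IsTest β →
        Integrable fun x => w x • (α x • gradient β x) := fun {α β} hα hβ => by
      have hs : HasCompactSupport (fun x => α x • gradient β x) :=
        HasCompactSupport.smul_left (f := α) (hasCompactSupport_gradient hβ.2)
      have hc : Continuous (fun x => α x • gradient β x) :=
        hα.1.continuous.smul hβ.continuous_gradient
      exact hw.locallyIntegrable.integrable_smul_right_of_hasCompactSupport hc hs
    have hi1 := hint hχ hφ
    have hi2 := hint hφ hχ
    have hi3 : Integrable fun x => (χ x * φ x) • H x :=
      hw.locallyIntegrable_grad.integrable_smul_left_of_hasCompactSupport hχφ.1.continuous hχφ.2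
    have e1 : ∀ x, w x • gradient (fun x => χ x * φ x) x
        = w x • (χ x • gradient φ x) + w x • (φ x • gradient χ x) := fun x => by
      rw [gradient_mul (hφ.differentiable x) (hχ.differentiable x), smul_add]
    have e2 : ∀ x, φ x • (χ x • H x + w x • gradient χ x)
        = (χ x * φ x) • H x + w x • (φ x • gradient χ x) := fun x => by
      rw [smul_add, smul_smul, mul_comm (χ x), smul_comm (φ x) (w x)]
    have e3 : ∀ x, (χ x * w x) • gradient φ x = w x • (χ x • gradient φ x) := fun x => by
      rw [smul_smul, mul_comm]
    simp only [e1] at h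
    simp only [e2, e3]
    rw [integral_add hi1 hi2] at h
    rw [integral_add hi3 hi2, eq_sub_of_add_eq h]
    abel

/-! ### Density of test functions in the homogeneous Sobolev space -/

/-- Dominated convergence in `L^r` for bounded factors that tend to zero almost everywhere. -/
theorem tendsto_eLpNorm_smul_of_ae_tendsto_zero {r : ℝ} (hr : 0 < r) {c : ℕ → E n → ℝ}
    (hcm : ∀ k, AEStronglyMeasurable (c k) volume) {C : ℝ} (hC : ∀ k x, |c k x| ≤ C)
    (hc : ∀ᵐ x ∂(volume : Measure (E n)), Tendsto (fun k => c k x) atTop (𝓝 0)) {f : E n → F}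
    (hf : MemLp f (ENNReal.ofReal r) volume) :
    Tendsto (fun k => eLpNorm (fun x => c k x • f x) (ENNReal.ofReal r) volume) atTop (𝓝 0) := by
  have hr0 : ENNReal.ofReal r ≠ 0 := by simpa using hr
  have hfin := lintegral_rpow_enorm_lt_top_of_eLpNorm_lt_top hr0 ENNReal.ofReal_ne_top
    hf.eLpNorm_lt_top
  simp only [eLpNorm_eq_lintegral_rpow_enorm_toReal hr0 ENNReal.ofReal_ne_top,
    ENNReal.toReal_ofReal hr.le] at hfin ⊢
  have hlim : Tendsto (fun k => ∫⁻ x, ‖c k x • f x‖ₑ ^ r) atTop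
      (𝓝 (∫⁻ _ : E n, (0 : ℝ≥0∞))) := by
    refine tendsto_lintegral_of_dominated_convergence'
      (fun x => ENNReal.ofReal C ^ r * ‖f x‖ₑ ^ r) (fun k => ((hcm k).smul hf.1).enorm.pow_const r)
      (fun k => Eventually.of_forall fun x => ?_) ?_ ?_
    · beta_reduce
      rw [← ENNReal.mul_rpow_of_nonneg _ _ hr.le, enorm_smul]
      gcongr
      rw [← ofReal_norm]
      exact ENNReal.ofReal_le_ofReal (hC k x)
    · rw [lintegral_const_mul' _ _ (ENNReal.rpow_ne_top_of_nonneg hr.le ENNReal.ofReal_ne_top)]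
      exact ENNReal.mul_ne_top (ENNReal.rpow_ne_top_of_nonneg hr.le ENNReal.ofReal_ne_top) hfin.ne
    · filter_upwards [hc] with x hx
      have h1 : Tendsto (fun k => c k x • f x) atTop (𝓝 0) := by
        simpa using hx.smul_const (f x)
      have h2 := h1.enorm
      rw [enorm_zero] at h2
      have h3 := ((ENNReal.continuous_rpow_const (y := r)).tendsto 0).comp h2
      rwa [ENNReal.zero_rpow_of_pos hr] at h3
  rw [lintegral_zero] at hlim
  have h4 := ((ENNReal.continuous_rpow_const (y := 1 / r)).tendsto 0).comp hlim
  rwa [ENNReal.zero_rpow_of_pos (by positivity)] at h4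

/-- Cutoff functions `χ k`, equal to one on the ball of radius `k + 1`, whose gradients are bounded
in `L^n`: this norm is invariant under dilation. -/
theorem exists_cutoff (hn : 0 < n) : ∃ χ : ℕ → E n → ℝ, (∀ k, IsTest (χ k)) ∧
    (∀ k x, |χ k x - 1| ≤ 1) ∧ (∀ (k : ℕ) x, ‖x‖ < k + 1 → χ k x = 1) ∧
    (∀ (k : ℕ) x, ‖x‖ < k + 1 → gradient (χ k) x = 0) ∧
    ∃ C : ℝ≥0∞, C ≠ ⊤ ∧ ∀ k, eLpNorm (gradient (χ k)) (ENNReal.ofReal n) volume ≤ C := by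
  let b : ContDiffBump (0 : E n) := ⟨1, 2, one_pos, one_lt_two⟩
  have hn' : (0 : ℝ) < n := by exact_mod_cast hn
  have hRpos : ∀ k : ℕ, (0 : ℝ) < k + 1 := fun k => by positivity
  have hone : ∀ (k : ℕ) (x : E n), ‖x‖ < k + 1 → b (((k : ℝ) + 1)⁻¹ • x) = 1 := fun k x hx => by
    apply b.one_of_mem_closedBall
    rw [mem_closedBall_zero_iff, norm_smul, norm_inv, Real.norm_of_nonneg (hRpos k).le,
      inv_mul_le_iff₀ (hRpos k)]
    simpa [b] using hx.le
  obtain ⟨C, hC⟩ := (b.hasCompactSupport.fderiv ℝ).exists_bound_of_continuous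
    ((b.contDiff (n := 1)).continuous_fderiv one_ne_zero)
  have hC0 : 0 ≤ C := (norm_nonneg _).trans (hC 0)
  have hgrad : ∀ (k : ℕ) (x : E n), ‖gradient (fun x => b (((k : ℝ) + 1)⁻¹ • x)) x‖
      ≤ ((k : ℝ) + 1)⁻¹ * C := fun k x => by
    rw [norm_gradient, fderiv_comp_smul, norm_smul, norm_inv, Real.norm_of_nonneg (hRpos k).le]
    have := hRpos k
    gcongr
    exact hC _
  have hsupp : ∀ k : ℕ, Function.support (gradient (fun x => b (((k : ℝ) + 1)⁻¹ • x)))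
      ⊆ Metric.closedBall (0 : E n) (2 * (k + 1)) := fun k x hx => by
    have hx' : fderiv ℝ (b : E n → ℝ) (((k : ℝ) + 1)⁻¹ • x) ≠ 0 := fun h => hx <| by
      rw [← norm_eq_zero, norm_gradient, fderiv_comp_smul, h, smul_zero, norm_zero]
    have := support_fderiv_subset ℝ hx'
    rw [b.tsupport_eq, mem_closedBall_zero_iff, norm_smul, norm_inv,
      Real.norm_of_nonneg (hRpos k).le, inv_mul_le_iff₀ (hRpos k)] at this
    rw [mem_closedBall_zero_iff]
    simpa [b, mul_comm] using this
  refine ⟨fun k x => b (((k : ℝ) + 1)⁻¹ • x), fun k => ⟨?_, ?_⟩, fun k x => ?_, hone,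
    fun k x hx => ?_, ?_⟩
  · exact b.contDiff.comp (contDiff_const_smul _)
  · exact b.hasCompactSupport.comp_homeomorph
      (Homeomorph.smulOfNeZero _ (inv_ne_zero (hRpos k).ne'))
  · have h0 := b.nonneg (x := ((k : ℝ) + 1)⁻¹ • x)
    have h1 := b.le_one (x := ((k : ℝ) + 1)⁻¹ • x)
    rw [abs_le]; constructor <;> linarith
  · have : (fun x => b (((k : ℝ) + 1)⁻¹ • x)) =ᶠ[𝓝 x] fun _ => (1 : ℝ) := by
      filter_upwards [(isOpen_lt continuous_norm continuous_const).mem_nhds hx] with y hy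
      exact hone k y hy
    rw [← norm_eq_zero, norm_gradient, this.fderiv_eq, fderiv_const_apply, norm_zero]
  · refine ⟨ENNReal.ofReal (2 * C) * volume (Metric.ball (0 : E n) 1) ^ (n : ℝ)⁻¹,
      ENNReal.mul_ne_top ENNReal.ofReal_ne_top
        (ENNReal.rpow_ne_top_of_nonneg (by positivity) measure_ball_lt_top.ne), fun k => ?_⟩
    have hk := hRpos k
    rw [← eLpNorm_restrict_eq_of_support_subset (hsupp k)]
    refine (eLpNorm_le_of_ae_bound (C := ((k : ℝ) + 1)⁻¹ * C)
      (Eventually.of_forall (hgrad k))).trans (le_of_eq ?_)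
    rw [Measure.restrict_apply_univ, Measure.addHaar_closedBall _ _ (by positivity),
      finrank_euclideanSpace_fin, ENNReal.toReal_ofReal hn'.le,
      ENNReal.mul_rpow_of_nonneg _ _ (by positivity), ENNReal.ofReal_pow (by positivity),
      ENNReal.pow_rpow_inv_natCast hn.ne', mul_right_comm, ← ENNReal.ofReal_mul (by positivity)]
    congr 2
    field_simp

theorem holderTriple_sobolev {p : ℝ} (hp : 1 < p) (hpn : p < n) :
    ENNReal.HolderTriple (ENNReal.ofReal (n * p / (n - p))) (ENNReal.ofReal n)
      (ENNReal.ofReal p) := by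
  have hn : (0 : ℝ) < n := by linarith
  have hnp : 0 < (n : ℝ) - p := by linarith
  refine ⟨?_⟩
  rw [← ENNReal.ofReal_inv_of_pos (by positivity), ← ENNReal.ofReal_inv_of_pos hn,
    ← ENNReal.ofReal_inv_of_pos (by linarith), ← ENNReal.ofReal_add (by positivity) (by positivity)]
  congr 1
  field_simp
  ring

theorem one_lt_sobolevExponent {p : ℝ} (hp : 1 < p) (hpn : p < n) : 1 < n * p / (n - p) := by
  rw [one_lt_div (by linarith)]
  nlinarith

/-- Test functions are dense in the homogeneous Sobolev space. -/
theorem exists_isTest_approx {p : ℝ} (hp : 1 < p) (hpn : p < n) {w : E n → ℝ} {H : E n → E n}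
    (hw : MemLp w (ENNReal.ofReal (n * p / (n - p))) volume)
    (hH : MemLp H (ENNReal.ofReal p) volume) (hwH : HasWeakGradient w H) {ε : ℝ≥0∞} (hε : 0 < ε) :
    ∃ φ : E n → ℝ, IsTest φ ∧ eLpNorm (φ - w) (ENNReal.ofReal (n * p / (n - p))) volume ≤ ε ∧
      eLpNorm (gradient φ - H) (ENNReal.ofReal p) volume ≤ ε := by
  have hn : 0 < n := by exact_mod_cast (by linarith : (0 : ℝ) < n)
  set s : ℝ := n * p / (n - p) with hs
  have hs1 : 1 < s := one_lt_sobolevExponent hp hpn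
  have hs1' : 1 ≤ ENNReal.ofReal s := by simpa using ENNReal.ofReal_le_ofReal hs1.le
  have hp1' : 1 ≤ ENNReal.ofReal p := by simpa using ENNReal.ofReal_le_ofReal hp.le
  have hH3 : ENNReal.HolderTriple (ENNReal.ofReal s) (ENNReal.ofReal n) (ENNReal.ofReal p) :=
    holderTriple_sobolev hp hpn
  obtain ⟨χ, hχ, hχ1, hχone, hχgrad, C, hC, hχC⟩ := exists_cutoff hn
  obtain ⟨δ, hδ, hδtop, hδε⟩ : ∃ δ : ℝ≥0∞, 0 < δ ∧ δ ≠ ⊤ ∧ δ + (δ + δ) ≤ ε := by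
    refine ⟨min (ε / 3) 1, lt_min (ENNReal.div_pos hε.ne' (by simp)) one_pos, by simp, ?_⟩
    refine le_trans ?_ (ENNReal.add_thirds ε).le
    rw [← add_assoc]
    gcongr <;> exact min_le_left _ _
  have hδε' : δ + δ ≤ ε := le_add_self.trans hδε
  -- the three error terms of the cutoff tend to zero
  have hlarge : ∀ x : E n, ∀ᶠ k : ℕ in atTop, ‖x‖ < k + 1 := fun x => by
    filter_upwards [(tendsto_natCast_atTop_atTop (R := ℝ)).eventually_gt_atTop ‖x‖] with k hk
    linarith
  have hχlim : ∀ᵐ x ∂(volume : Measure (E n)), Tendsto (fun k => χ k x - 1) atTop (𝓝 0) :=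
    Eventually.of_forall fun x => tendsto_const_nhds.congr' <| by
      filter_upwards [hlarge x] with k hk
      rw [hχone k x hk, sub_self]
  have hχm : ∀ k, AEStronglyMeasurable (fun x => χ k x - 1) volume := fun k =>
    ((hχ k).1.continuous.sub continuous_const).aestronglyMeasurable
  have t1 := tendsto_eLpNorm_smul_of_ae_tendsto_zero (by linarith) hχm hχ1 hχlim hw
  have t2 := tendsto_eLpNorm_smul_of_ae_tendsto_zero (by linarith) hχm hχ1 hχlim hH
  -- the gradient of the cutoff lives where `|x| ≥ k + 1`, so Hölder's inequality only involves the
  -- tail of `w`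
  let c : ℕ → E n → ℝ := fun k => Set.indicator {x | (k : ℝ) + 1 ≤ ‖x‖} 1
  have hcm : ∀ k, AEStronglyMeasurable (c k) volume := fun k =>
    (measurable_one.indicator (isClosed_le continuous_const
      continuous_norm).measurableSet).aestronglyMeasurable
  have hc1 : ∀ k x, |c k x| ≤ 1 := fun k x => by
    by_cases h : (k : ℝ) + 1 ≤ ‖x‖ <;> simp [c, h]
  have hclim : ∀ᵐ x ∂(volume : Measure (E n)), Tendsto (fun k => c k x) atTop (𝓝 0) :=
    Eventually.of_forall fun x => tendsto_const_nhds.congr' <| by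
      filter_upwards [hlarge x] with k hk
      simp [c, hk]
  have t3 := tendsto_eLpNorm_smul_of_ae_tendsto_zero (by linarith) hcm hc1 hclim hw
  have t3' : Tendsto (fun k => eLpNorm (fun x => w x • gradient (χ k) x) (ENNReal.ofReal p) volume)
      atTop (𝓝 0) := by
    have hlim := ENNReal.Tendsto.mul_const (b := C) t3 (Or.inr hC)
    rw [zero_mul] at hlim
    refine tendsto_of_tendsto_of_tendsto_of_le_of_le tendsto_const_nhds hlim
      (fun _ => zero_le) fun k => ?_
    have heq : (fun x => w x • gradient (χ k) x)
        = (fun x => c k x • w x) • gradient (χ k) := by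
      ext1 x
      by_cases h : (k : ℝ) + 1 ≤ ‖x‖
      · simp [c, h]
      · change w x • gradient (χ k) x = (c k x • w x) • gradient (χ k) x
        rw [hχgrad k x (not_le.1 h), smul_zero, smul_zero]
    change eLpNorm (fun x => w x • gradient (χ k) x) (ENNReal.ofReal p) volume ≤ _
    rw [heq]
    refine (eLpNorm_smul_le_mul_eLpNorm (hpqr := hH3) (hχ k).continuous_gradient.aestronglyMeasurable
      ((hcm k).smul hw.1)).trans ?_
    exact mul_le_mul' le_rfl (hχC k)
  obtain ⟨k, ⟨hk1, hk2⟩, hk3⟩ := (((ENNReal.tendsto_nhds_zero.1 t1 δ hδ).and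
    (ENNReal.tendsto_nhds_zero.1 t2 δ hδ)).and (ENNReal.tendsto_nhds_zero.1 t3' δ hδ)).exists
  set wk : E n → ℝ := fun x => χ k x * w x with hwk
  set Hk : E n → E n := fun x => χ k x • H x + w x • gradient (χ k) x with hHk
  have hwkH : HasWeakGradient wk Hk := hwH.test_mul (hχ k)
  have ewk : wk - w = fun x => (χ k x - 1) • w x := by
    ext x; simp [hwk, sub_mul]
  have eHk : Hk - H = (fun x => (χ k x - 1) • H x) + fun x => w x • gradient (χ k) x := by
    ext1 x; simp only [hHk, Pi.sub_apply, Pi.add_apply, sub_smul, one_smul]; abel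
  have hm1 : AEStronglyMeasurable (fun x => (χ k x - 1) • w x) volume := (hχm k).smul hw.1
  have hm2 : AEStronglyMeasurable (fun x => (χ k x - 1) • H x) volume := (hχm k).smul hH.1
  have hm3 : AEStronglyMeasurable (fun x => w x • gradient (χ k) x) volume :=
    hw.1.smul (hχ k).continuous_gradient.aestronglyMeasurable
  have hwk1 : eLpNorm (wk - w) (ENNReal.ofReal s) volume ≤ δ := by rw [ewk]; exact hk1
  have hHk1 : eLpNorm (Hk - H) (ENNReal.ofReal p) volume ≤ δ + δ := by
    rw [eHk]
    exact (eLpNorm_add_le hm2 hm3 hp1').trans (add_le_add hk2 hk3)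
  have hwkm : MemLp wk (ENNReal.ofReal s) volume := by
    have : MemLp (wk - w) (ENNReal.ofReal s) volume :=
      ⟨by rw [ewk]; exact hm1, hwk1.trans_lt hδtop.lt_top⟩
    simpa using this.add hw
  have hHkm : MemLp Hk (ENNReal.ofReal p) volume := by
    have : MemLp (Hk - H) (ENNReal.ofReal p) volume :=
      ⟨by rw [eHk]; exact hm2.add hm3,
        hHk1.trans_lt (ENNReal.add_ne_top.2 ⟨hδtop, hδtop⟩).lt_top⟩
    simpa using this.add hH
  -- mollify the truncated function
  let b : ℕ → ContDiffBump (0 : E n) := fun j =>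
    ⟨((j : ℝ) + 1)⁻¹, 2 * ((j : ℝ) + 1)⁻¹, by positivity, by
      have : (0 : ℝ) < ((j : ℝ) + 1)⁻¹ := by positivity
      linarith⟩
  have hb : Tendsto (fun j => (b j).rOut) atTop (𝓝 0) := by
    have := (tendsto_one_div_add_atTop_nhds_zero_nat (𝕜 := ℝ)).const_mul 2
    simpa [b] using this
  obtain ⟨j, hj1, hj2⟩ := ((ENNReal.tendsto_nhds_zero.1
    (tendsto_eLpNorm_mollify_sub hb hs1.le hwkm) δ hδ).and (ENNReal.tendsto_nhds_zero.1
    (tendsto_eLpNorm_mollify_sub hb hp.le hHkm) δ hδ)).exists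
  refine ⟨mollify (b j) wk, ⟨contDiff_mollify _ hwkH.locallyIntegrable,
    hasCompactSupport_mollify _ (hχ k).2.mul_right⟩, ?_, ?_⟩
  · have e : mollify (b j) wk - w = (mollify (b j) wk - wk) + (wk - w) := by abel
    rw [e]
    refine (eLpNorm_add_le ?_ (hwkm.1.sub hw.1) hs1').trans ((add_le_add hj1 hwk1).trans hδε')
    exact (contDiff_mollify _ hwkH.locallyIntegrable).continuous.aestronglyMeasurable.sub hwkm.1
  · rw [gradient_mollify _ hwkH]
    have e : mollify (b j) Hk - H = (mollify (b j) Hk - Hk) + (Hk - H) := by abel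
    rw [e]
    refine (eLpNorm_add_le ?_ (hHkm.1.sub hH.1) hp1').trans ((add_le_add hj2 hHk1).trans hδε)
    exact (contDiff_mollify _
      hwkH.locallyIntegrable_grad).continuous.aestronglyMeasurable.sub hHkm.1

/-! ### The nonlinearity of the `p`-Laplacian -/

/-- The nonlinearity `a ↦ |a|^{p-2} a` of the `p`-Laplacian. -/
def pFlux (p : ℝ) (a : E n) : E n := ‖a‖ ^ (p - 2) • a

/-- At `s = 0` both sides vanish, whatever the value of `0 ^ (p - 2)`. -/
theorem rpow_sub_two_mul {p : ℝ} (hp : 1 < p) {s : ℝ} (hs : 0 ≤ s) :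
    s ^ (p - 2) * s = s ^ (p - 1) := by
  rcases hs.eq_or_lt with h | h
  · rw [← h, mul_zero, Real.zero_rpow (by linarith)]
  · rw [← Real.rpow_add_one h.ne']; ring_nf

theorem norm_pFlux {p : ℝ} (hp : 1 < p) (a : E n) : ‖pFlux p a‖ = ‖a‖ ^ (p - 1) := by
  rw [pFlux, norm_smul, Real.norm_of_nonneg (by positivity),
    rpow_sub_two_mul hp (norm_nonneg a)]

/-- The monotonicity form splits into two nonnegative terms, one for
the lengths and one for the angle. -/
theorem inner_pFlux_sub (p : ℝ) (a b : E n) :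
    inner ℝ (pFlux p a - pFlux p b) (a - b)
      = (‖a‖ ^ (p - 2) * ‖a‖ - ‖b‖ ^ (p - 2) * ‖b‖) * (‖a‖ - ‖b‖)
        + (‖a‖ ^ (p - 2) + ‖b‖ ^ (p - 2)) * (‖a‖ * ‖b‖ - inner ℝ a b) := by
  simp only [pFlux, inner_sub_left, inner_sub_right, real_inner_smul_left,
    real_inner_self_eq_norm_sq, real_inner_comm a b]
  ring

theorem inner_pFlux_sub_terms_nonneg {p : ℝ} (hp : 1 < p) (a b : E n) :
    0 ≤ (‖a‖ ^ (p - 2) * ‖a‖ - ‖b‖ ^ (p - 2) * ‖b‖) * (‖a‖ - ‖b‖) ∧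
    0 ≤ (‖a‖ ^ (p - 2) + ‖b‖ ^ (p - 2)) * (‖a‖ * ‖b‖ - inner ℝ a b) := by
  constructor
  · rw [rpow_sub_two_mul hp (norm_nonneg a), rpow_sub_two_mul hp (norm_nonneg b)]
    rcases le_total ‖a‖ ‖b‖ with h | h
    · exact mul_nonneg_of_nonpos_of_nonpos (sub_nonpos.2 (by gcongr)) (sub_nonpos.2 h)
    · exact mul_nonneg (sub_nonneg.2 (by gcongr)) (sub_nonneg.2 h)
  · exact mul_nonneg (by positivity) (sub_nonneg.2 (real_inner_le_norm a b))

theorem inner_pFlux_sub_nonneg {p : ℝ} (hp : 1 < p) (a b : E n) :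
    0 ≤ inner ℝ (pFlux p a - pFlux p b) (a - b) := by
  rw [inner_pFlux_sub]
  exact add_nonneg (inner_pFlux_sub_terms_nonneg hp a b).1 (inner_pFlux_sub_terms_nonneg hp a b).2

/-- Strict monotonicity of `a ↦ |a|^{p-2} a`. -/
theorem eq_of_inner_pFlux_sub_eq_zero {p : ℝ} (hp : 1 < p) {a b : E n}
    (h : inner ℝ (pFlux p a - pFlux p b) (a - b) = 0) : a = b := by
  rw [inner_pFlux_sub] at h
  obtain ⟨h1, h2⟩ := inner_pFlux_sub_terms_nonneg hp a b
  have e1 := (add_eq_zero_iff_of_nonneg h1 h2).1 h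
  obtain ⟨e1, e2⟩ := e1
  have hab : ‖a‖ = ‖b‖ := by
    rcases mul_eq_zero.1 e1 with e | e
    · rw [rpow_sub_two_mul hp (norm_nonneg a), rpow_sub_two_mul hp (norm_nonneg b),
        sub_eq_zero] at e
      exact (Real.rpow_left_inj (norm_nonneg a) (norm_nonneg b) (by linarith)).1 e
    · exact sub_eq_zero.1 e
  rcases (norm_nonneg b).eq_or_lt with hb | hb
  · rw [← hb] at hab
    rw [norm_eq_zero.1 hab, norm_eq_zero.1 hb.symm]
  · rw [hab] at e2
    have hpos : 0 < ‖b‖ ^ (p - 2) + ‖b‖ ^ (p - 2) := by positivity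
    have e3 := (mul_eq_zero.1 e2).resolve_left hpos.ne'
    have : ‖a - b‖ ^ 2 = 0 := by
      rw [norm_sub_sq_real, hab]; linarith
    exact sub_eq_zero.1 (norm_eq_zero.1 (by simpa using this))

theorem memLp_pFlux {p : ℝ} (hp : 1 < p) {G : E n → E n}
    (hG : MemLp G (ENNReal.ofReal p) volume) :
    MemLp (fun x => pFlux p (G x)) (ENNReal.ofReal (p / (p - 1))) volume := by
  have h := hG.norm_rpow_div (ENNReal.ofReal (p - 1))
  rw [ENNReal.toReal_ofReal (by linarith), ← ENNReal.ofReal_div_of_pos (by linarith)] at h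
  refine h.of_le ?_ (Eventually.of_forall fun x => ?_)
  · exact (hG.1.norm.aemeasurable.pow_const (p - 2)).aestronglyMeasurable.smul hG.1
  · rw [norm_pFlux hp, Real.norm_of_nonneg (by positivity)]

theorem holderTriple_conjugate {p : ℝ} (hp : 1 < p) :
    ENNReal.HolderTriple (ENNReal.ofReal (p / (p - 1))) (ENNReal.ofReal p) 1 :=
  (Real.HolderConjugate.conjExponent hp).symm.ennrealOfReal

theorem eLpNorm_inner_le {p : ℝ} (hp : 1 < p) {A X : E n → E n}
    (hA : AEStronglyMeasurable A volume) (hX : AEStronglyMeasurable X volume) :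
    eLpNorm (fun x => inner ℝ (A x) (X x)) 1 volume
      ≤ eLpNorm A (ENNReal.ofReal (p / (p - 1))) volume * eLpNorm X (ENNReal.ofReal p) volume := by
  have h := eLpNorm_le_eLpNorm_mul_eLpNorm_of_nnnorm hA hX (fun a b => inner ℝ a b) 1
    (Eventually.of_forall fun x => by
      rw [one_mul]; exact nnnorm_inner_le_nnnorm _ _) (hpqr := holderTriple_conjugate hp)
  simpa using h

theorem integrable_inner_of_memLp {p : ℝ} (hp : 1 < p) {A X : E n → E n}
    (hA : MemLp A (ENNReal.ofReal (p / (p - 1))) volume) (hX : MemLp X (ENNReal.ofReal p) volume) :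
    Integrable (fun x => inner ℝ (A x) (X x)) volume :=
  memLp_one_iff_integrable.1 ⟨hA.1.inner hX.1, (eLpNorm_inner_le hp hA.1 hX.1).trans_lt
    (ENNReal.mul_lt_top hA.2 hX.2)⟩

theorem tendsto_integral_inner {p : ℝ} (hp : 1 < p) {A X : E n → E n} {Y : ℕ → E n → E n}
    (hA : MemLp A (ENNReal.ofReal (p / (p - 1))) volume) (hX : MemLp X (ENNReal.ofReal p) volume)
    (hY : ∀ k, MemLp (Y k) (ENNReal.ofReal p) volume)
    (hlim : Tendsto (fun k => eLpNorm (Y k - X) (ENNReal.ofReal p) volume) atTop (𝓝 0)) :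
    Tendsto (fun k => ∫ x, inner ℝ (A x) (Y k x)) atTop (𝓝 (∫ x, inner ℝ (A x) (X x))) := by
  refine tendsto_integral_of_L1 _ (hA.1.inner hX.1)
    (Eventually.of_forall fun k => integrable_inner_of_memLp hp hA (hY k)) ?_
  have h := ENNReal.Tendsto.const_mul (a := eLpNorm A (ENNReal.ofReal (p / (p - 1))) volume) hlim
    (Or.inr hA.2.ne)
  rw [mul_zero] at h
  refine tendsto_of_tendsto_of_tendsto_of_le_of_le tendsto_const_nhds h (fun _ => zero_le)
    fun k => ?_
  refine le_trans (le_of_eq ?_) (eLpNorm_inner_le hp hA.1 ((hY k).1.sub hX.1))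
  rw [eLpNorm_one_eq_lintegral_enorm]
  simp only [Pi.sub_apply, inner_sub_right]

/-! ### A smooth positive part -/

theorem deriv_expNegInvGlue (t : ℝ) : deriv expNegInvGlue t = t⁻¹ ^ 2 * expNegInvGlue t := by
  have h := (expNegInvGlue.hasDerivAt_polynomial_eval_inv_mul 1 t).deriv
  simpa using h

theorem deriv_expNegInvGlue_nonneg (t : ℝ) : 0 ≤ deriv expNegInvGlue t := by
  rw [deriv_expNegInvGlue]
  exact mul_nonneg (sq_nonneg _) (expNegInvGlue.nonneg t)

theorem deriv_expNegInvGlue_le (t : ℝ) : deriv expNegInvGlue t ≤ 2 := by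
  rw [deriv_expNegInvGlue]
  rcases le_or_gt t 0 with h | h
  · simp [expNegInvGlue.zero_of_nonpos h]
  · have h1 : 0 ≤ t⁻¹ := by positivity
    have h2 := Real.quadratic_le_exp_of_nonneg h1
    rw [expNegInvGlue, if_neg (not_le.2 h), Real.exp_neg, ← div_eq_mul_inv,
      div_le_iff₀ (Real.exp_pos _)]
    nlinarith

theorem continuous_deriv_expNegInvGlue : Continuous (deriv expNegInvGlue) :=
  (expNegInvGlue.contDiff (n := 1)).continuous_deriv (by simp)

theorem gradient_comp {ψ : ℝ → ℝ} {φ : E n → ℝ} {x : E n} (hψ : DifferentiableAt ℝ ψ (φ x))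
    (hφ : DifferentiableAt ℝ φ x) :
    gradient (fun y => ψ (φ y)) x = deriv ψ (φ x) • gradient φ x := by
  have h : fderiv ℝ (fun y => ψ (φ y)) x = deriv ψ (φ x) • fderiv ℝ φ x :=
    (hψ.hasDerivAt.comp_hasFDerivAt x hφ.hasFDerivAt).fderiv
  rw [gradient, h, map_smul]; rfl

theorem IsTest.comp {φ : E n → ℝ} (hφ : IsTest φ) {ψ : ℝ → ℝ} (hψ : ContDiff ℝ ∞ ψ)
    (h0 : ψ 0 = 0) : IsTest fun x => ψ (φ x) :=
  ⟨hψ.comp hφ.1, hφ.2.comp_left h0⟩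

theorem IsTest.memLp_gradient {φ : E n → ℝ} (hφ : IsTest φ) (q : ℝ≥0∞) :
    MemLp (gradient φ) q volume :=
  hφ.continuous_gradient.memLp_of_hasCompactSupport (hasCompactSupport_gradient hφ.2)

/-- `ψ ∘ w`, for the smooth nondecreasing function `ψ = expNegInvGlue` that vanishes exactly on
`(-∞, 0]`, is approximated by nonnegative test functions; it takes the role of the positive part
of `w`. -/
theorem exists_nonneg_isTest_approx {p : ℝ} (hp : 1 < p) (hpn : p < n) {w : E n → ℝ}
    {H : E n → E n} (hw : MemLp w (ENNReal.ofReal (n * p / (n - p))) volume)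
    (hH : MemLp H (ENNReal.ofReal p) volume) (hwH : HasWeakGradient w H) :
    ∃ φ : ℕ → E n → ℝ, (∀ k, IsTest (φ k)) ∧ (∀ k x, 0 ≤ φ k x) ∧
      (∀ᵐ x ∂(volume : Measure (E n)),
        Tendsto (fun k => φ k x) atTop (𝓝 (expNegInvGlue (w x)))) ∧
      Tendsto (fun k => eLpNorm (gradient (φ k) - fun x => deriv expNegInvGlue (w x) • H x)
        (ENNReal.ofReal p) volume) atTop (𝓝 0) := by
  have hs1 := one_lt_sobolevExponent hp hpn
  have hp1' : 1 ≤ ENNReal.ofReal p := by simpa using ENNReal.ofReal_le_ofReal hp.le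
  have hε : ∀ k : ℕ, (0 : ℝ≥0∞) < ((k : ℝ≥0∞) + 1)⁻¹ := fun k => by simp
  choose g hg hgw hgH using fun k => exists_isTest_approx hp hpn hw hH hwH (hε k)
  have hεlim : Tendsto (fun k : ℕ => ((k : ℝ≥0∞) + 1)⁻¹) atTop (𝓝 0) := by
    have := (tendsto_add_atTop_iff_nat 1).2 ENNReal.tendsto_inv_nat_nhds_zero
    simpa using this
  have hgw' := tendsto_of_tendsto_of_tendsto_of_le_of_le tendsto_const_nhds hεlim
    (fun _ => zero_le) hgw
  have hgH' := tendsto_of_tendsto_of_tendsto_of_le_of_le tendsto_const_nhds hεlim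
    (fun _ => zero_le) hgH
  obtain ⟨ns, hns, hae⟩ := (tendstoInMeasure_of_tendsto_eLpNorm
    (by simpa using (zero_lt_one.trans hs1))
    (fun k => (hg k).1.continuous.aestronglyMeasurable) hw.1 hgw').exists_seq_tendsto_ae
  have hψ : ContDiff ℝ ∞ expNegInvGlue := expNegInvGlue.contDiff (n := ⊤)
  have hd : Differentiable ℝ expNegInvGlue := hψ.differentiable (by simp)
  have hc := continuous_deriv_expNegInvGlue
  refine ⟨fun k x => expNegInvGlue (g (ns k) x), fun k => (hg _).comp hψ expNegInvGlue.zero,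
    fun k x => expNegInvGlue.nonneg _, ?_, ?_⟩
  · filter_upwards [hae] with x hx
    exact (hψ.continuous.tendsto _).comp hx
  · have hcm : ∀ k, AEStronglyMeasurable (fun x => deriv expNegInvGlue (g (ns k) x)
        - deriv expNegInvGlue (w x)) volume := fun k =>
      (hc.comp (hg (ns k)).1.continuous).aestronglyMeasurable.sub
        (hc.comp_aestronglyMeasurable hw.1)
    have hcb : ∀ k x, |deriv expNegInvGlue (g (ns k) x) - deriv expNegInvGlue (w x)| ≤ 2 := by
      intro k x
      have h1 := deriv_expNegInvGlue_nonneg (g (ns k) x)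
      have h2 := deriv_expNegInvGlue_le (g (ns k) x)
      have h3 := deriv_expNegInvGlue_nonneg (w x)
      have h4 := deriv_expNegInvGlue_le (w x)
      rw [abs_le]; constructor <;> linarith
    have hclim : ∀ᵐ x ∂(volume : Measure (E n)), Tendsto (fun k =>
        deriv expNegInvGlue (g (ns k) x) - deriv expNegInvGlue (w x)) atTop (𝓝 0) := by
      filter_upwards [hae] with x hx
      have := ((hc.tendsto _).comp hx).sub_const (deriv expNegInvGlue (w x))
      simpa using this
    have t1 := tendsto_eLpNorm_smul_of_ae_tendsto_zero (by linarith) hcm hcb hclim hH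
    have t2 := ENNReal.Tendsto.const_mul (a := ENNReal.ofReal 2) (hgH'.comp hns.tendsto_atTop)
      (Or.inr ENNReal.ofReal_ne_top)
    have t3 := t2.add t1
    rw [mul_zero, add_zero] at t3
    refine tendsto_of_tendsto_of_tendsto_of_le_of_le tendsto_const_nhds t3 (fun _ => zero_le)
      fun k => ?_
    have e : (gradient (fun x => expNegInvGlue (g (ns k) x))
          - fun x => deriv expNegInvGlue (w x) • H x)
        = (fun x => deriv expNegInvGlue (g (ns k) x) • (gradient (g (ns k)) x - H x))
          + fun x => (deriv expNegInvGlue (g (ns k) x) - deriv expNegInvGlue (w x)) • H x := by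
      ext1 x
      simp only [Pi.sub_apply, Pi.add_apply]
      rw [gradient_comp (hd _) ((hg _).differentiable x), smul_sub, sub_smul]
      abel
    have hm1 : AEStronglyMeasurable (fun x => deriv expNegInvGlue (g (ns k) x) •
        (gradient (g (ns k)) x - H x)) volume :=
      (hc.comp (hg (ns k)).1.continuous).aestronglyMeasurable.smul
        ((hg (ns k)).continuous_gradient.aestronglyMeasurable.sub hH.1)
    change eLpNorm (gradient (fun x => expNegInvGlue (g (ns k) x))
          - fun x => deriv expNegInvGlue (w x) • H x) _ _ ≤ _
    rw [e]
    refine (eLpNorm_add_le hm1 ((hcm k).smul hH.1) hp1').trans ?_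
    refine add_le_add ?_ le_rfl
    refine eLpNorm_le_mul_eLpNorm_of_ae_le_mul (Eventually.of_forall fun x => ?_) _
    rw [norm_smul, Real.norm_of_nonneg (deriv_expNegInvGlue_nonneg _)]
    exact mul_le_mul_of_nonneg_right (deriv_expNegInvGlue_le _) (norm_nonneg _)

/-! ### Comparison almost everywhere -/

/-- The Gagliardo–Nirenberg–Sobolev inequality for test functions. -/
theorem exists_sobolev_const {p : ℝ} (hp : 1 < p) (hpn : p < n) : ∃ C : ℝ≥0,
    ∀ φ : E n → ℝ, IsTest φ → eLpNorm φ (ENNReal.ofReal (n * p / (n - p))) volume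
      ≤ C * eLpNorm (gradient φ) (ENNReal.ofReal p) volume := by
  refine ⟨eLpNormLESNormFDerivOfEqInnerConst (volume : Measure (E n)) p, fun φ hφ => ?_⟩
  have hs1 := one_lt_sobolevExponent hp hpn
  have hn0 : (0 : ℝ) < n := by linarith
  have hnp : 0 < (n : ℝ) - p := by linarith
  have h := eLpNorm_le_eLpNorm_fderiv_of_eq_inner (volume : Measure (E n)) (hφ.1.of_le (by simp))
    hφ.2 (p := p.toNNReal) (p' := (n * p / (n - p)).toNNReal)
    (by simpa using Real.toNNReal_le_toNNReal hp.le)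
    (by rw [finrank_euclideanSpace_fin]; exact_mod_cast hn0) (by
      rw [finrank_euclideanSpace_fin, Real.coe_toNNReal _ (by linarith), NNReal.coe_inv,
        Real.coe_toNNReal _ (by linarith)]
      field_simp)
  rw [Real.coe_toNNReal _ (by linarith)] at h
  refine h.trans (le_of_eq ?_)
  congr 1
  exact eLpNorm_congr_norm_ae (Eventually.of_forall fun x => (norm_gradient φ x).symm)

/-- The comparison principle almost everywhere. -/
theorem ae_le_of_solvesPLaplace {p : ℝ} (hp : 1 < p) (hpn : p < n) {μ ν : Measure (E n)}
    [IsFiniteMeasureOnCompacts μ] [IsFiniteMeasureOnCompacts ν] {u v : E n → ℝ}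
    (hu : MemL01p p u) (hv : MemL01p p v) (huμ : SolvesPLaplace p u μ)
    (hvν : SolvesPLaplace p v ν) (hle : μ ≤ ν) : ∀ᵐ x ∂(volume : Measure (E n)), u x ≤ v x := by
  have hs1 := one_lt_sobolevExponent hp hpn
  obtain ⟨-, hus, G, hG, hGp⟩ := hu
  obtain ⟨-, hvs, K, hK, hKp⟩ := hv
  obtain ⟨G', hG', huμ⟩ := huμ
  obtain ⟨K', hK', hvν⟩ := hvν
  have hGG := hG'.ae_eq hG
  have hKK := hK'.ae_eq hK
  have hAG := memLp_pFlux hp hGp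
  have hAK := memLp_pFlux hp hKp
  have hA := hAG.sub hAK
  have hws := hus.sub hvs
  have hHp := hGp.sub hKp
  obtain ⟨φ, hφ, hφ0, hφlim, hφgrad⟩ := exists_nonneg_isTest_approx hp hpn hws hHp (hG.sub hK)
  set Z : E n → E n := fun x => deriv expNegInvGlue ((u - v) x) • (G - K) x with hZ
  have hZm : AEStronglyMeasurable Z volume :=
    (continuous_deriv_expNegInvGlue.comp_aestronglyMeasurable hws.1).smul hHp.1
  have hZp : MemLp Z (ENNReal.ofReal p) volume := by
    refine (hHp.const_smul (2 : ℝ)).of_le hZm (Eventually.of_forall fun x => ?_)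
    rw [hZ, norm_smul, Pi.smul_apply, norm_smul,
      Real.norm_of_nonneg (deriv_expNegInvGlue_nonneg _), Real.norm_of_nonneg zero_le_two]
    exact mul_le_mul_of_nonneg_right (deriv_expNegInvGlue_le _) (norm_nonneg _)
  -- test the two equations with the nonnegative functions `φ k`
  have htest : ∀ k, ∫ x, inner ℝ (((fun x => pFlux p (G x)) - fun x => pFlux p (K x)) x)
      (gradient (φ k) x) ≤ 0 := fun k => by
    have h1 : ∫ x, inner ℝ (pFlux p (G x)) (gradient (φ k) x) = ∫ x, φ k x ∂μ := by
      rw [← huμ _ (hφ k)]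
      refine integral_congr_ae ?_
      filter_upwards [hGG] with x hx
      rw [hx, pFlux, real_inner_smul_left]
    have h2 : ∫ x, inner ℝ (pFlux p (K x)) (gradient (φ k) x) = ∫ x, φ k x ∂ν := by
      rw [← hvν _ (hφ k)]
      refine integral_congr_ae ?_
      filter_upwards [hKK] with x hx
      rw [hx, pFlux, real_inner_smul_left]
    simp only [Pi.sub_apply, inner_sub_left]
    rw [integral_sub (integrable_inner_of_memLp hp hAG ((hφ k).memLp_gradient _))
      (integrable_inner_of_memLp hp hAK ((hφ k).memLp_gradient _)), h1, h2, sub_nonpos]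
    exact integral_mono_measure hle (Eventually.of_forall (hφ0 k))
      ((hφ k).1.continuous.integrable_of_hasCompactSupport (hφ k).2)
  have hlim := le_of_tendsto' (tendsto_integral_inner hp hA hZp
    (fun k => (hφ k).memLp_gradient _) hφgrad) htest
  -- the limit integrand is nonnegative by monotonicity, hence it vanishes
  have hnonneg : ∀ x, 0 ≤ inner ℝ (((fun x => pFlux p (G x)) - fun x => pFlux p (K x)) x) (Z x) := by
    intro x
    rw [hZ, real_inner_smul_right]
    exact mul_nonneg (deriv_expNegInvGlue_nonneg _) (inner_pFlux_sub_nonneg hp _ _)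
  have hzero := (integral_eq_zero_iff_of_nonneg hnonneg (integrable_inner_of_memLp hp hA hZp)).1
    (le_antisymm hlim (integral_nonneg hnonneg))
  have hZ0 : Z =ᵐ[volume] 0 := by
    filter_upwards [hzero] with x hx
    rw [hZ, Pi.zero_apply, real_inner_smul_right] at hx
    rcases mul_eq_zero.1 hx with h | h
    · rw [hZ]; beta_reduce; rw [h, zero_smul, Pi.zero_apply]
    · have := eq_of_inner_pFlux_sub_eq_zero hp h
      simp [hZ, this]
  have hgrad0 : Tendsto (fun k => eLpNorm (gradient (φ k)) (ENNReal.ofReal p) volume) atTop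
      (𝓝 0) := by
    refine hφgrad.congr fun k => eLpNorm_congr_ae ?_
    filter_upwards [hZ0] with x hx
    change gradient (φ k) x - Z x = _
    rw [hx, Pi.zero_apply, sub_zero]
  obtain ⟨C, hC⟩ := exists_sobolev_const hp hpn
  have hφs0 : Tendsto (fun k => eLpNorm (φ k) (ENNReal.ofReal (n * p / (n - p))) volume) atTop
      (𝓝 0) := by
    have h := ENNReal.Tendsto.const_mul (a := (C : ℝ≥0∞)) hgrad0 (Or.inr ENNReal.coe_ne_top)
    rw [mul_zero] at h
    exact tendsto_of_tendsto_of_tendsto_of_le_of_le tendsto_const_nhds h (fun _ => zero_le)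
      fun k => hC _ (hφ k)
  have hfatou := Lp.eLpNorm_lim_le_liminf_eLpNorm (p := ENNReal.ofReal (n * p / (n - p)))
    (fun k => (hφ k).1.continuous.aestronglyMeasurable) _ hφlim
  -- `ψ(u - v)` has zero norm, so `u - v` lies in the zero set `(-∞, 0]` of `ψ`
  rw [hφs0.liminf_eq, nonpos_iff_eq_zero, eLpNorm_eq_zero_iff
    (expNegInvGlue.contDiff (n := 0).continuous.comp_aestronglyMeasurable hws.1)
    (by simpa using zero_lt_one.trans hs1)] at hfatou
  filter_upwards [hfatou] with x hx
  have := expNegInvGlue.zero_iff_nonpos.1 hx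
  simpa using this

/-! ### Capacity and quasicontinuity -/

/-- A smooth substitute for `6|t|`: nonnegative, `6`-Lipschitz, zero at `0` and at least `2` for
`t ≥ 1`. -/
def smoothAbs (t : ℝ) : ℝ := 6 * (√(1 + t ^ 2) - 1)

theorem smoothAbs_zero : smoothAbs 0 = 0 := by simp [smoothAbs]

theorem smoothAbs_nonneg (t : ℝ) : 0 ≤ smoothAbs t := by
  have : 1 ≤ √(1 + t ^ 2) := Real.one_le_sqrt.2 (by nlinarith [sq_nonneg t])
  rw [smoothAbs]; linarith

theorem two_le_smoothAbs {t : ℝ} (ht : 1 ≤ t) : 2 ≤ smoothAbs t := by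
  have : 4 / 3 ≤ √(1 + t ^ 2) := Real.le_sqrt_of_sq_le (by nlinarith)
  rw [smoothAbs]; linarith

theorem contDiff_smoothAbs : ContDiff ℝ ∞ smoothAbs := by
  refine contDiff_const.mul (ContDiff.sub (ContDiff.sqrt ?_ fun t => ?_) contDiff_const)
  · exact contDiff_const.add (contDiff_id.pow 2)
  · positivity

theorem abs_deriv_smoothAbs_le (t : ℝ) : |deriv smoothAbs t| ≤ 6 := by
  have hpos : 0 < 1 + t ^ 2 := by positivity
  have h : HasDerivAt smoothAbs (6 * (2 * t / (2 * √(1 + t ^ 2)))) t := by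
    have h1 : HasDerivAt (fun t : ℝ => 1 + t ^ 2) (2 * t) t := by
      simpa using ((hasDerivAt_id t).pow 2).const_add 1
    exact ((h1.sqrt hpos.ne').sub_const 1).const_mul 6
  rw [h.deriv, abs_mul, abs_div, abs_of_pos (show (0 : ℝ) < 6 by norm_num),
    abs_of_pos (show 0 < 2 * √(1 + t ^ 2) by positivity), abs_mul,
    abs_of_pos (zero_lt_two (α := ℝ)), mul_div_mul_left _ _ two_ne_zero]
  have : |t| / √(1 + t ^ 2) ≤ 1 := by
    rw [div_le_one (by positivity)]
    exact Real.le_sqrt_of_sq_le (by rw [sq_abs]; linarith)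
  linarith

theorem IsTest.add {φ χ : E n → ℝ} (hφ : IsTest φ) (hχ : IsTest χ) :
    IsTest fun x => φ x + χ x :=
  ⟨hφ.1.add hχ.1, hφ.2.add hχ.2⟩

theorem IsTest.mollify {φ : E n → ℝ} (hφ : IsTest φ) (b : ContDiffBump (0 : E n)) :
    IsTest (mollify b φ) :=
  ⟨contDiff_mollify b hφ.1.continuous.locallyIntegrable, hasCompactSupport_mollify b hφ.2⟩

/-- Mollification does not increase the energy of a test function. -/
theorem IsTest.energy_mollify_le {φ : E n → ℝ} (hφ : IsTest φ) (b : ContDiffBump (0 : E n)) {p : ℝ}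
    (hp : 1 ≤ p) :
    ∫⁻ x, ‖gradient (PLap.mollify b φ) x‖ₑ ^ p ≤ ∫⁻ x, ‖gradient φ x‖ₑ ^ p := by
  simp only [enorm_gradient]
  rw [fderiv_mollify b (hφ.1.of_le (by simp)) hφ.2]
  exact lintegral_enorm_mollify_rpow_le b
    (hφ.1.continuous_fderiv (by simp)).aestronglyMeasurable hp

theorem capCompact_le {p : ℝ} {K : Set (E n)} {φ : E n → ℝ} (hφ : IsTest φ)
    (hK : ∀ x ∈ K, 1 ≤ φ x) : capCompact p K ≤ ∫⁻ x, ‖gradient φ x‖ₑ ^ p :=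
  iInf₂_le_of_le φ hφ (iInf_le _ hK)

theorem exists_isTest_of_capOpen_lt {p : ℝ} {O L : Set (E n)} {ε : ℝ≥0∞} (hO : capOpen p O < ε)
    (hL : IsCompact L) (hLO : L ⊆ O) :
    ∃ φ : E n → ℝ, IsTest φ ∧ (∀ x ∈ L, 1 ≤ φ x) ∧ ∫⁻ x, ‖gradient φ x‖ₑ ^ p < ε := by
  have h : capCompact p L < ε :=
    (le_iSup₂_of_le L hL (le_iSup (fun _ : L ⊆ O => capCompact p L) hLO)).trans_lt hO
  simpa only [capCompact, iInf_lt_iff, exists_prop] using h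

/-- A nonnegative function that is at least `2` on most of a neighbourhood of `x` has mollification
at least `1` at `x`. -/
theorem one_le_mollify (b : ContDiffBump (0 : E n)) {g : E n → ℝ} (hg : Continuous g)
    (hg0 : ∀ x, 0 ≤ g x) {L B : Set (E n)} (hL : MeasurableSet L) (hB : MeasurableSet B)
    (hBfin : volume B ≠ ⊤) (hgL : ∀ x ∈ L, 2 ≤ g x) {M : ℝ} (hM : ∀ t, b.normed volume t ≤ M)
    (hMB : M * (volume (B \ L)).toReal ≤ 1 / 2) {x : E n}
    (hx : Metric.ball x b.rOut ⊆ B) : 1 ≤ mollify b g x := by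
  have hfin : volume (B \ L) ≠ ⊤ := measure_ne_top_of_subset Set.sdiff_subset hBfin
  have hi1 : Integrable (fun t => b.normed volume (x - t)) volume :=
    b.integrable_normed.comp_sub_left x
  have hi2 : Integrable ((B \ L).indicator fun _ => M) volume :=
    (integrable_indicator_iff (hB.diff hL)).2 (integrableOn_const hfin)
  have hi3 : Integrable (fun t => b.normed volume (x - t) • g t) volume := by
    refine hg.locallyIntegrable.integrable_smul_left_of_hasCompactSupport
      (b.continuous_normed.comp (continuous_const.sub continuous_id)) ?_
    exact b.hasCompactSupport_normed.comp_homeomorph (Homeomorph.subLeft x)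
  -- off `L` the left side is nonpositive, by the bound `M` inside `B` and as `t` is outside the
  -- support of the kernel otherwise
  have hpt : ∀ t, 2 * (b.normed volume (x - t) - (B \ L).indicator (fun _ => M) t)
      ≤ b.normed volume (x - t) • g t := by
    intro t
    have h0 := b.nonneg_normed (μ := volume) (x - t)
    have hgt := hg0 t
    rw [smul_eq_mul]
    by_cases htL : t ∈ L
    · rw [Set.indicator_of_notMem (fun h => h.2 htL)]
      nlinarith [hgL t htL]
    by_cases htB : t ∈ B
    · have htBL : t ∈ B \ L := ⟨htB, htL⟩
      rw [Set.indicator_of_mem htBL]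
      nlinarith [hM (x - t), mul_nonneg h0 hgt]
    · have : b.normed volume (x - t) = 0 := by
        rw [← Function.notMem_support, b.support_normed_eq, mem_ball_zero_iff]
        intro h
        exact htB (hx (by rwa [Metric.mem_ball, dist_comm, dist_eq_norm]))
      rw [Set.indicator_of_notMem (fun h => htB h.1), this]
      simp
  have hint := integral_mono ((hi1.sub hi2).const_mul 2) hi3 hpt
  rw [integral_const_mul, integral_sub' hi1 hi2, integral_indicator (hB.diff hL),
    setIntegral_const, integral_sub_left_eq_self (fun t => b.normed volume t) volume x,
    b.integral_normed] at hint
  rw [mollify_apply']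
  rw [smul_eq_mul, Measure.real] at hint
  linarith

/-- An open set that is covered, up to a Lebesgue null set, by two open sets of small capacity has
small capacity. -/
theorem capOpen_le_of_volume_diff_eq_zero {p : ℝ} (hp : 1 ≤ p) {O₁ O₂ W : Set (E n)}
    (hO₁ : IsOpen O₁) (hO₂ : IsOpen O₂) (hW : IsOpen W) (hvol : volume (W \ (O₁ ∪ O₂)) = 0)
    {ε : ℝ≥0∞} (h₁ : capOpen p O₁ < ε) (h₂ : capOpen p O₂ < ε) :
    capOpen p W ≤ 2 ^ (p - 1) * 6 ^ p * (ε + ε) := by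
  have hp0 : 0 ≤ p := by linarith
  refine iSup_le fun K => iSup₂_le fun hK hKW => ?_
  obtain ⟨δ, hδ, hδW⟩ := hK.exists_cthickening_subset_open hW hKW
  set B := Metric.cthickening δ K with hB
  have hBc : IsCompact B := hK.cthickening
  let b : ContDiffBump (0 : E n) := ⟨δ / 2, δ, by positivity, by linarith⟩
  obtain ⟨M, hM⟩ := b.hasCompactSupport_normed.exists_bound_of_continuous
    (b.continuous_normed (μ := volume))
  have hM0 : 0 ≤ M := (norm_nonneg _).trans (hM 0)
  -- exhaust the part of `B` in the two open sets by a compact set, up to measure `1 / (2 (M + 1))`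
  have hOm : MeasurableSet (B ∩ (O₁ ∪ O₂)) :=
    hBc.measurableSet.inter (hO₁.union hO₂).measurableSet
  obtain ⟨L, hLB, hL, hLvol⟩ := hOm.exists_isCompact_sdiff_lt
    (μ := volume) (measure_ne_top_of_subset Set.inter_subset_left hBc.measure_lt_top.ne)
    (ε := ENNReal.ofReal (1 / (2 * (M + 1)))) (by
      rw [Ne, ENNReal.ofReal_eq_zero, not_le]; positivity)
  have hBL : volume (B \ L) ≤ ENNReal.ofReal (1 / (2 * (M + 1))) := by
    have hsub : B \ L ⊆ ((B ∩ (O₁ ∪ O₂)) \ L) ∪ (W \ (O₁ ∪ O₂)) := by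
      intro x hx
      by_cases hxO : x ∈ O₁ ∪ O₂
      · exact Or.inl ⟨⟨hx.1, hxO⟩, hx.2⟩
      · exact Or.inr ⟨hδW hx.1, hxO⟩
    refine (measure_mono hsub).trans ((measure_union_le _ _).trans ?_)
    rw [hvol, add_zero]
    exact hLvol.le
  have hMB : M * (volume (B \ L)).toReal ≤ 1 / 2 := by
    have h := ENNReal.toReal_mono ENNReal.ofReal_ne_top hBL
    rw [ENNReal.toReal_ofReal (by positivity)] at h
    calc M * (volume (B \ L)).toReal ≤ M * (1 / (2 * (M + 1))) := by gcongr
      _ ≤ 1 / 2 := by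
        rw [mul_one_div, div_le_div_iff₀ (by positivity) two_pos]; linarith
  obtain ⟨L₁, L₂, hL₁, hL₂, hL₁O, hL₂O, hLL⟩ :=
    hL.binary_compact_cover hO₁ hO₂ (hLB.trans Set.inter_subset_right)
  obtain ⟨φ₁, hφ₁, hφL₁, he₁⟩ := exists_isTest_of_capOpen_lt h₁ hL₁ hL₁O
  obtain ⟨φ₂, hφ₂, hφL₂, he₂⟩ := exists_isTest_of_capOpen_lt h₂ hL₂ hL₂O
  set g : E n → ℝ := fun x => smoothAbs (φ₁ x) + smoothAbs (φ₂ x) with hg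
  have hg₁ := hφ₁.comp contDiff_smoothAbs smoothAbs_zero
  have hg₂ := hφ₂.comp contDiff_smoothAbs smoothAbs_zero
  have hgt : IsTest g := hg₁.add hg₂
  have hgL : ∀ x ∈ L, 2 ≤ g x := by
    intro x hx
    have n1 := smoothAbs_nonneg (φ₁ x)
    have n2 := smoothAbs_nonneg (φ₂ x)
    rw [hLL] at hx
    rcases hx with hx | hx
    · have := two_le_smoothAbs (hφL₁ x hx); simp only [hg]; linarith
    · have := two_le_smoothAbs (hφL₂ x hx); simp only [hg]; linarith
  have hcap := capCompact_le (p := p) (K := K) (hgt.mollify b) fun x hx =>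
    one_le_mollify b hgt.1.continuous
      (fun x => add_nonneg (smoothAbs_nonneg _) (smoothAbs_nonneg _)) hL.measurableSet
      hBc.measurableSet hBc.measure_lt_top.ne hgL (fun t => (Real.le_norm_self _).trans (hM t))
      hMB (Metric.ball_subset_closedBall.trans (Metric.closedBall_subset_cthickening hx δ))
  refine hcap.trans ((hgt.energy_mollify_le b hp).trans ?_)
  have hgrad : ∀ {φ : E n → ℝ}, IsTest φ → ∀ x,
      ‖gradient (fun x => smoothAbs (φ x)) x‖ₑ ≤ 6 * ‖gradient φ x‖ₑ := by
    intro φ hφ x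
    rw [gradient_comp (contDiff_smoothAbs.differentiable (by simp) _) (hφ.differentiable x),
      enorm_smul]
    gcongr
    rw [← ofReal_norm, Real.norm_eq_abs]
    refine (ENNReal.ofReal_le_ofReal (abs_deriv_smoothAbs_le _)).trans ?_
    simp
  have hpt : ∀ x, ‖gradient g x‖ₑ ^ p
      ≤ 2 ^ (p - 1) * 6 ^ p * (‖gradient φ₁ x‖ₑ ^ p + ‖gradient φ₂ x‖ₑ ^ p) := by
    intro x
    have e : gradient g x = gradient (fun x => smoothAbs (φ₁ x)) x
        + gradient (fun x => smoothAbs (φ₂ x)) x := by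
      simp only [gradient, hg]
      rw [fderiv_fun_add (hg₁.differentiable x) (hg₂.differentiable x), map_add]
    calc ‖gradient g x‖ₑ ^ p
        ≤ (6 * ‖gradient φ₁ x‖ₑ + 6 * ‖gradient φ₂ x‖ₑ) ^ p := by
          gcongr
          rw [e]
          exact (enorm_add_le _ _).trans (add_le_add (hgrad hφ₁ x) (hgrad hφ₂ x))
      _ = 6 ^ p * (‖gradient φ₁ x‖ₑ + ‖gradient φ₂ x‖ₑ) ^ p := by
          rw [← mul_add, ENNReal.mul_rpow_of_nonneg _ _ hp0]
      _ ≤ 6 ^ p * (2 ^ (p - 1) * (‖gradient φ₁ x‖ₑ ^ p + ‖gradient φ₂ x‖ₑ ^ p)) := by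
          gcongr
          exact ENNReal.rpow_add_le_mul_rpow_add_rpow _ _ hp
      _ = _ := by ring
  refine (lintegral_mono hpt).trans ?_
  rw [lintegral_const_mul' _ _ (by finiteness),
    lintegral_add_left' (hφ₁.continuous_gradient.aestronglyMeasurable.enorm.pow_const p)]
  gcongr

theorem capOpen_le_cap {p : ℝ} (O : Set (E n)) : capOpen p O ≤ cap p O := by
  refine le_iInf fun U => le_iInf₂ fun _ hOU => ?_
  exact iSup_mono fun K => iSup_mono fun _ => iSup_mono' fun h => ⟨h.trans hOU, le_rfl⟩

/-- An inequality between quasicontinuous functions that holds almost everywhere holds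
quasi-everywhere. -/
theorem quasiEverywhere_le_of_ae_le {p : ℝ} (hp : 1 ≤ p) {f g : E n → EReal}
    (hf : Quasicontinuous p f) (hg : Quasicontinuous p g)
    (hfg : ∀ᵐ x ∂(volume : Measure (E n)), f x ≤ g x) :
    QuasiEverywhere p fun x => f x ≤ g x := by
  have hp0 : 0 ≤ p := by linarith
  by_contra hne
  obtain ⟨ε, hε, hεlt⟩ := ENNReal.exists_pos_mul_lt
    (a := 2 ^ (p - 1) * 6 ^ p * 2) (by finiteness) hne
  obtain ⟨O₁, hO₁, hc₁, hf⟩ := hf ε hε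
  obtain ⟨O₂, hO₂, hc₂, hg⟩ := hg ε hε
  set W : Set (E n) := {x | ¬ f x ≤ g x} ∪ (O₁ ∪ O₂) with hWdef
  have hW : IsOpen W := by
    have hcl : IsClosed (O₁ ∪ O₂)ᶜ := (hO₁.union hO₂).isClosed_compl
    have := hcl.isClosed_le (hf.mono (Set.compl_subset_compl.2 Set.subset_union_left))
      (hg.mono (Set.compl_subset_compl.2 Set.subset_union_right))
    convert this.isOpen_compl using 1
    ext x
    simp only [hWdef, Set.mem_union, Set.mem_ofPred_eq, Set.mem_compl_iff]
    tauto
  have hvol : volume (W \ (O₁ ∪ O₂)) = 0 :=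
    measure_mono_null (fun x hx => hx.1.resolve_right hx.2) hfg
  have h := capOpen_le_of_volume_diff_eq_zero hp hO₁ hO₂ hW hvol
    ((capOpen_le_cap _).trans_lt hc₁) ((capOpen_le_cap _).trans_lt hc₂)
  have hcap : cap p {x | ¬ f x ≤ g x} ≤ capOpen p W :=
    iInf₂_le_of_le W hW (iInf_le _ Set.subset_union_left)
  refine absurd (hcap.trans h) (not_le.2 ?_)
  refine lt_of_eq_of_lt ?_ hεlt
  ring

end PLap
end

theorem lemma3p7 (n : ℕ) (p : ℝ) (hp : 1 < p) (hpn : p < n)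
    (μ ω : MeasureTheory.Measure (PLap.E n))
    [MeasureTheory.IsFiniteMeasureOnCompacts μ] [MeasureTheory.IsFiniteMeasureOnCompacts ω]
    (hμ : PLap.MemDual p μ) (hω : PLap.MemDual p ω)
    (u v : PLap.E n → ℝ) (hu : PLap.MemL01p p u) (hv : PLap.MemL01p p v)
    (huμ : PLap.SolvesPLaplace p u μ) (hvω : PLap.SolvesPLaplace p v ω)
    (hle : μ ≤ ω)
    (u' v' : PLap.E n → EReal)
    (hu' : PLap.IsQuasicontinuousRep p u' u) (hv' : PLap.IsQuasicontinuousRep p v' v) :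
    PLap.QuasiEverywhere p (fun x => u' x ≤ v' x) := by
  refine PLap.quasiEverywhere_le_of_ae_le hp.le hu'.1 hv'.1 ?_
  filter_upwards [PLap.ae_le_of_solvesPLaplace hp hpn hu hv huμ hvω hle, hu'.2, hv'.2]
    with x hx hux hvx
  rw [hux, hvx]
  exact_mod_cast hx
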